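/- **Theorem 4 (Bayesian agent regret of Thompson sampling).** Consider a contextual bandit with a non-empty finite set of contexts $S$, with $K\ge 1$ arms, and with $N\ge 1$ agents. A problem instance $\theta$ is drawn once from a prior on a standard Borel space. In each round $h=1,\dots,H$, given $\theta$ and the past, the $N$ agents interact independently of each other: agent $n$ receives a context $s_h^n\sim P_S$, takes an arm $A_h^n\sim\pi_h(\cdot\mid s_h^n)$, and obtains a reward $r_h^n\sim P_R(\cdot\mid s_h^n,A_h^n)$, where $P_R$ depends on $\theta$. The policy $\pi_h$ is the same for all agents and depends on the contexts, arms and rewards of all agents in rounds $1,\dots,h-1$. Let $\mu(s,a)$ be the mean reward of arm $a$ in context $s$, and let $a^*(s)\in\arg\max_a\mu(s,a)$ be chosen by a fixed measurable tie-breaking rule. Assume that $\mu(s,a)\in[0,1]$ and that the rewards are $1$-sub-Gaussian about their means (for example, rewards in $[0,1]$). Let $\pi$ be Thompson sampling: $\pi_h(\cdot\mid s)$ is the law of the maximiser (with the same tie-breaking rule) of $a\mapsto\hat\mu(s,a)$, where $\hat\mu(s,\cdot)$ is sampled from the posterior distribution of $\mu(s,\cdot)$ given the observations of rounds $1,\dots,h-1$.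 Put $T=NH$ and $$\mathrm{BR}(\pi,T)=\mathbb E\Big[\sum_{h=1}^H\sum_{n=1}^N\big(\mu(s_h^n,a^*(s_h^n))-\mu(s_h^n,A_h^n)\big)\Big],\qquad \mathrm{BR}_n(\pi,T)=\mathbb E\Big[\sum_{h=1}^H\big(\mu(s_h^n,a^*(s_h^n))-\mu(s_h^n,A_h^n)\big)\Big].$$ Then for every agent $n$ and every $H$ (with the convention $\log 0=0$ when $H=0$), $$\mathrm{BR}_n(\pi,T)=\frac{\mathrm{BR}(\pi,T)}{N},\qquad \mathrm{BR}_n(\pi,T)\le 2K|S|+4\sqrt{\frac{(2+6\log T)\,K|S|\,T}{N}}.$$ Moreover there are a universal constant $C>0$ and a threshold $T_0=T_0(K,|S|,N)$ such that for all $T=NH\ge T_0$ $$\mathrm{BR}_n(\pi,T)\le \frac{C}{N}\sqrt{K\,T\,|S|\log T}.$$ -/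

import Mathlib

open MeasureTheory ProbabilityTheory
open scoped NNReal

noncomputable section

namespace ContextualBandit

/-- What the decision-maker observes in one round: context, action and reward of every agent. -/
abbrev Round (S : Type*) (K N : ℕ) : Type _ := Fin N → S × Fin K × ℝ

/-- The observations of the first `h` rounds, with all agents pooled. -/
abbrev Hist (S : Type*) (K N h : ℕ) : Type _ := Fin h → Round S K N

/-- The independent product of `N` copies of a probability kernel: given `x`, draw `N` independent
samples from `κ x`. -/
def iidKernel {α β : Type*} [MeasurableSpace α] [MeasurableSpace β] (N : ℕ)
    (κ : Kernel α β) [IsMarkovKernel κ] : Kernel α (Fin N → β) where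
  toFun x := Measure.pi fun _ : Fin N => κ x
  measurable' := by
    refine Measurable.measure_of_isPiSystem_of_isProbabilityMeasure
      generateFrom_pi.symm isPiSystem_pi ?_
    rintro _ ⟨t, ht, rfl⟩
    simp only [Measure.pi_pi]
    exact Finset.measurable_prod _ fun i _ => κ.measurable_coe (ht i (Set.mem_univ i))

instance {α β : Type*} [MeasurableSpace α] [MeasurableSpace β] (N : ℕ)
    (κ : Kernel α β) [IsMarkovKernel κ] : IsMarkovKernel (iidKernel N κ) :=
  ⟨fun x => inferInstanceAs (IsProbabilityMeasure (Measure.pi fun _ : Fin N => κ x))⟩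

/-- A Bayesian contextual multi-armed bandit with contexts `S`, problem instances `Θ` and `K` arms:
the context distribution, the prior on the problem instance, and the reward distribution
`P_R(· | s, a)` of each instance. -/
structure Bandit (S Θ : Type*) [MeasurableSpace S] [MeasurableSpace Θ] (K : ℕ) where
  ctx : Measure S
  prior : Measure Θ
  reward : Kernel (Θ × S × Fin K) ℝ
  [prob_ctx : IsProbabilityMeasure ctx]
  [prob_prior : IsProbabilityMeasure prior]
  [markov_reward : IsMarkovKernel reward]

attribute [instance] Bandit.prob_ctx Bandit.prob_prior Bandit.markov_reward

/-- A policy common to all agents: in round `h` (counted from `0`), a distribution on the arms given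
the pooled observations of the previous `h` rounds and the context of the agent. -/
structure Policy (S : Type*) [MeasurableSpace S] (K N : ℕ) where
  act : ∀ h : ℕ, Kernel (Hist S K N h × S) (Fin K)
  [markov_act : ∀ h, IsMarkovKernel (act h)]

attribute [instance] Policy.markov_act

/-- A measurable way to pick, in every context, a maximiser of a vector of `K` numbers. -/
structure ArgmaxRule (S : Type*) (K : ℕ) where
  pick : S → (Fin K → ℝ) → Fin K
  measurable_pick : ∀ s, Measurable (pick s)
  le_pick : ∀ (s : S) (v : Fin K → ℝ) (a : Fin K), v a ≤ v (pick s v)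

variable {S Θ : Type*} [MeasurableSpace S] [MeasurableSpace Θ] {K N : ℕ}

namespace Bandit

variable (B : Bandit S Θ K)

/-- The mean reward `μ(s, a)` in the instance `θ`. -/
def mean (θ : Θ) (s : S) (a : Fin K) : ℝ := ∫ r, r ∂(B.reward (θ, s, a))

/-- One interaction of one agent, given the instance and the past: a context drawn from the context
distribution, an arm drawn from `p`, a reward drawn from the reward distribution. -/
def agentKernel {h : ℕ} (p : Kernel (Hist S K N h × S) (Fin K)) :
    Kernel (Θ × Hist S K N h) (S × Fin K × ℝ) :=
  Kernel.const _ B.ctx ⊗ₖ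
    (p.comap (fun x : (Θ × Hist S K N h) × S => (x.1.2, x.2)) (by fun_prop) ⊗ₖ
      B.reward.comap (fun x : ((Θ × Hist S K N h) × S) × Fin K => (x.1.1.1, x.1.2, x.2))
        (by fun_prop))

instance {h : ℕ} (p : Kernel (Hist S K N h × S) (Fin K)) [IsMarkovKernel p] :
    IsMarkovKernel (B.agentKernel p) := by
  unfold agentKernel; infer_instance

/-- Append a round to the history. -/
def append {h : ℕ} (x : Hist S K N h × Round S K N) : Hist S K N (h + 1) :=
  Fin.snoc (α := fun _ => Round S K N) x.1 x.2

lemma measurable_append {h : ℕ} : Measurable (append (S := S) (K := K) (N := N) (h := h)) := by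
  refine measurable_pi_lambda _ fun i => ?_
  refine Fin.lastCases ?_ (fun j => ?_) i
  · simpa [append] using measurable_snd
  · simp only [append, Fin.snoc_castSucc]
    exact (measurable_pi_apply j).comp measurable_fst

/-- The law of the history after one more round, in which the `N` agents interact independently
given the instance and the past, all of them with the same policy `p`. -/
def extend {h : ℕ} (κ : Kernel Θ (Hist S K N h)) (p : Kernel (Hist S K N h × S) (Fin K))
    [IsMarkovKernel p] : Kernel Θ (Hist S K N (h + 1)) :=
  (κ ⊗ₖ iidKernel N (B.agentKernel p)).map append

instance {h : ℕ} (κ : Kernel Θ (Hist S K N h)) [IsMarkovKernel κ]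
    (p : Kernel (Hist S K N h × S) (Fin K)) [IsMarkovKernel p] :
    IsMarkovKernel (B.extend κ p) :=
  Kernel.IsMarkovKernel.map _ measurable_append

/-- The law of the first `h` rounds in the instance `θ` when all agents follow the policy `π`. -/
def histKernel (π : Policy S K N) : ∀ h : ℕ, Kernel Θ (Hist S K N h)
  | 0 => Kernel.const _ (Measure.dirac Fin.elim0)
  | h + 1 => B.extend (histKernel π h) (π.act h)

instance (π : Policy S K N) (h : ℕ) : IsMarkovKernel (B.histKernel π h) := by
  induction h with
  | zero => unfold histKernel; infer_instance
  | succ h ih => unfold histKernel; infer_instance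

/-- The loss in mean reward of one interaction `z` (context, arm, reward) in the instance `θ`,
with respect to the optimal arm `a*(s)`. -/
def gap (ρ : ArgmaxRule S K) (θ : Θ) (z : S × Fin K × ℝ) : ℝ :=
  B.mean θ z.1 (ρ.pick z.1 (B.mean θ z.1)) - B.mean θ z.1 z.2.1

/-- The Bayesian system regret of `π` over `H` rounds: the expectation is over the instance, the
contexts, the actions and the rewards. -/
def systemRegret (ρ : ArgmaxRule S K) (π : Policy S K N) (H : ℕ) : ℝ :=
  ∫ x : Θ × Hist S K N H, ∑ h : Fin H, ∑ n : Fin N, B.gap ρ x.1 (x.2 h n)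
    ∂(B.prior ⊗ₘ B.histKernel π H)

/-- The Bayesian regret of the single agent `n` over `H` rounds. -/
def agentRegret (ρ : ArgmaxRule S K) (π : Policy S K N) (H : ℕ) (n : Fin N) : ℝ :=
  ∫ x : Θ × Hist S K N H, ∑ h : Fin H, B.gap ρ x.1 (x.2 h n)
    ∂(B.prior ⊗ₘ B.histKernel π H)

/-- `sampleArm ρ P s` is the law of the arm obtained by sampling an instance from `P`, hence a
vector of mean rewards in context `s`, and picking a maximiser of this vector. -/
def sampleArm (ρ : ArgmaxRule S K) (P : Measure Θ) (s : S) : Measure (Fin K) :=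
  (P.map (fun θ => B.mean θ s)).map (ρ.pick s)

/-- `π` is Thompson sampling: given the observed history, the arm of an agent in context `s` is
obtained by sampling the mean rewards in context `s` from their posterior distribution and
maximising. (The posterior is unique up to a null set of histories.) -/
def IsThompsonSampling [StandardBorelSpace Θ] [Nonempty Θ] (ρ : ArgmaxRule S K)
    (π : Policy S K N) : Prop :=
  ∀ h : ℕ, ∀ᵐ x ∂(B.histKernel π h ∘ₘ B.prior), ∀ s : S,
    π.act h (x, s) = B.sampleArm ρ (posterior (B.histKernel π h) B.prior x) s

/-- Rewards are normalised: mean rewards lie in `[0, 1]` and each reward is `1`-sub-Gaussian about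
its mean. -/
def Normalized : Prop :=
  ∀ θ s a, B.mean θ s a ∈ Set.Icc (0 : ℝ) 1 ∧
    HasSubgaussianMGF (fun r : ℝ => r - B.mean θ s a) (1 : ℝ≥0) (B.reward (θ, s, a))

end Bandit

end ContextualBandit

end

noncomputable section

namespace ContextualBandit

open scoped ENNReal

/-! Given the past and the instance, all agents of a round have the same law. Hence each agent's
regret is the same sum of one-round regrets (`Normalized.agentRegret_eq`), and the system regret is
`N` times it.

The one-round regret is bounded by optimism in expectation. Let `U` be an upper confidence bound
computed from the history, and let `A` and `a*` be the played and the optimal arm. Split the gap as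
`(μ(a*) - U(a*)) + (U(a*) - U(A)) + (U(A) - μ(A))`. Given the history and the context, `A` and `a*`
have the same law under Thompson sampling, so the middle term has mean zero
(`IsThompsonSampling.integral_arm_eq_integral_bestArm`). Off a bad event the first term is
nonpositive and the last is at most a confidence width (`Normalized.gap_le`). The bad event is rare
by a Chernoff bound with an exponential supermartingale (`Normalized.jointLaw_badEvent_le`).

The history is frozen during a round, so one pair can be played `N` times at the same width. A
potential that lags by `N` observations absorbs this (`mul_width_le_potential_sub`). Its sum over
pairs telescopes over rounds, and Cauchy-Schwarz bounds the final value. The agents' total is thus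
of order `N K|S| + √(K|S| T log T)`, and dividing by `N` gives the gain from pooling. -/

lemma integrable_of_measurable_of_abs_le {α : Type*} [MeasurableSpace α] {μ : Measure α}
    [IsFiniteMeasure μ] {f : α → ℝ} {C : ℝ} (hf : Measurable f) (hC : ∀ x, |f x| ≤ C) :
    Integrable f μ :=
  Integrable.of_bound hf.aestronglyMeasurable C (ae_of_all _ hC)

/-! ### Marginals and independence under the product kernel -/

section iidKernel

variable {α β : Type*} [MeasurableSpace α] [MeasurableSpace β] {N : ℕ}
  (κ : Kernel α β) [IsMarkovKernel κ]

lemma iidKernel_apply (x : α) : iidKernel N κ x = Measure.pi fun _ : Fin N => κ x := rfl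

lemma integral_iidKernel_eval {f : β → ℝ} (hf : Measurable f) (x : α) (n : Fin N) :
    ∫ y, f (y n) ∂(iidKernel N κ x) = ∫ z, f z ∂(κ x) := by
  have h := measurePreserving_eval (fun _ : Fin N => κ x) n
  have e := integral_map (f := f) (μ := Measure.pi fun _ : Fin N => κ x)
    h.measurable.aemeasurable hf.aestronglyMeasurable
  rw [h.map_eq] at e
  exact e.symm

/-- Conditional independence of the agents makes exponential weights multiply within a round, so a
whole round can be added to the supermartingale at once. -/
lemma lintegral_iidKernel_prod {g : β → ℝ≥0∞} (hg : Measurable g) (x : α) :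
    ∫⁻ y, ∏ n : Fin N, g (y n) ∂(iidKernel N κ x) = (∫⁻ z, g z ∂(κ x)) ^ N := by
  have hind : iIndepFun (fun (n : Fin N) (y : Fin N → β) => g (y n))
      (Measure.pi fun _ : Fin N => κ x) :=
    iIndepFun_pi (X := fun _ => g) fun _ => hg.aemeasurable
  rw [iidKernel_apply, lintegral_prod_eq_prod_lintegral_of_indepFun _ _ hind
    fun n => hg.comp (measurable_pi_apply n)]
  have (n : Fin N) : ∫⁻ y, g (y n) ∂(Measure.pi fun _ : Fin N => κ x) = ∫⁻ z, g z ∂(κ x) :=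
    (measurePreserving_eval (fun _ : Fin N => κ x) n).lintegral_comp hg
  simp [this]

end iidKernel

namespace Bandit

lemma append_castSucc {S : Type*} {K N h : ℕ} (x : Hist S K N h) (y : Round S K N) (i : Fin h) :
    append (x, y) i.castSucc = x i := by
  simp [append]

lemma append_last {S : Type*} {K N h : ℕ} (x : Hist S K N h) (y : Round S K N) :
    append (x, y) (Fin.last h) = y := by
  simp [append]

variable {S Θ : Type*} [MeasurableSpace S] [MeasurableSpace Θ] {K N : ℕ} (B : Bandit S Θ K)

/-! ### Measurability of means, optimal arms and gaps -/

section Measurability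

lemma measurable_mean_uncurry : Measurable fun q : Θ × S × Fin K => B.mean q.1 q.2.1 q.2.2 :=
  (StronglyMeasurable.integral_kernel (κ := B.reward) (f := fun r : ℝ => r)
    measurable_id.stronglyMeasurable).measurable

@[fun_prop]
lemma measurable_mean (s : S) (a : Fin K) : Measurable fun θ => B.mean θ s a :=
  B.measurable_mean_uncurry.comp (f := fun θ => (θ, s, a)) (by fun_prop)

lemma measurable_mean_vec (s : S) : Measurable fun θ => B.mean θ s :=
  measurable_pi_lambda _ fun a => B.measurable_mean s a

variable [Fintype S] [DiscreteMeasurableSpace S]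

lemma measurable_bestArm (ρ : ArgmaxRule S K) :
    Measurable fun q : Θ × S => ρ.pick q.2 (B.mean q.1 q.2) :=
  measurable_from_prod_countable_left fun s =>
    (ρ.measurable_pick s).comp (B.measurable_mean_vec s)

lemma measurable_gap (ρ : ArgmaxRule S K) :
    Measurable fun q : Θ × S × Fin K × ℝ => B.gap ρ q.1 q.2 := by
  unfold gap
  refine Measurable.sub ?_ ?_
  · have h : Measurable fun q : Θ × S × Fin K × ℝ =>
        (q.1, q.2.1, ρ.pick q.2.1 (B.mean q.1 q.2.1)) :=
      measurable_fst.prodMk (measurable_snd.fst.prodMk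
        ((B.measurable_bestArm ρ).comp (measurable_fst.prodMk measurable_snd.fst)))
    exact B.measurable_mean_uncurry.comp h
  · have h : Measurable fun q : Θ × S × Fin K × ℝ => (q.1, q.2.1, q.2.2.1) := by fun_prop
    exact B.measurable_mean_uncurry.comp h

end Measurability

variable {B} in
lemma Normalized.abs_gap_le (hB : B.Normalized) (ρ : ArgmaxRule S K) (θ : Θ)
    (z : S × Fin K × ℝ) : |B.gap ρ θ z| ≤ 1 := by
  have h1 := (hB θ z.1 (ρ.pick z.1 (B.mean θ z.1))).1
  have h2 := (hB θ z.1 z.2.1).1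
  rw [gap, abs_le]
  constructor <;> linarith [h1.1, h1.2, h2.1, h2.2]

/-! ### One-step recursion for the laws, and symmetry between agents -/

section Dynamics

variable (π : Policy S K N)

/-- The joint law of the instance and of the first `h` rounds. -/
def jointLaw (h : ℕ) : Measure (Θ × Hist S K N h) := B.prior ⊗ₘ B.histKernel π h

instance (h : ℕ) : IsProbabilityMeasure (B.jointLaw π h) := by
  unfold jointLaw; infer_instance

lemma jointLaw_succ (h : ℕ) :
    B.jointLaw π (h + 1) = (B.jointLaw π h ⊗ₘ iidKernel N (B.agentKernel (π.act h))).map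
      fun q => (q.1.1, append (q.1.2, q.2)) := by
  have e : B.histKernel π (h + 1) =
    (B.histKernel π h ⊗ₖ iidKernel N (B.agentKernel (π.act h))).map append := rfl
  rw [jointLaw, jointLaw, e, Measure.compProd_map measurable_append, ← Measure.compProd_assoc,
    Measure.map_map (by have := measurable_append (S := S) (K := K) (N := N) (h := h); fun_prop)
      (MeasurableEquiv.measurable _)]
  rfl

lemma measurable_append_snd {h : ℕ} : Measurable
    fun q : (Θ × Hist S K N h) × Round S K N => (q.1.1, append (q.1.2, q.2)) :=
  measurable_fst.fst.prodMk (measurable_append.comp (measurable_fst.snd.prodMk measurable_snd))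

lemma integral_jointLaw_succ {h : ℕ} {F : Θ × Hist S K N (h + 1) → ℝ} {C : ℝ}
    (hF : Measurable F) (hC : ∀ q, |F q| ≤ C) :
    ∫ q, F q ∂(B.jointLaw π (h + 1)) = ∫ q, ∫ y, F (q.1, append (q.2, y))
      ∂(iidKernel N (B.agentKernel (π.act h)) q) ∂(B.jointLaw π h) := by
  rw [jointLaw_succ, integral_map measurable_append_snd.aemeasurable hF.aestronglyMeasurable,
    Measure.integral_compProd]
  exact integrable_of_measurable_of_abs_le (hF.comp measurable_append_snd) fun q => hC _

lemma lintegral_histKernel_succ {h : ℕ} {F : Hist S K N (h + 1) → ℝ≥0∞} (hF : Measurable F)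
    (θ : Θ) :
    ∫⁻ x, F x ∂(B.histKernel π (h + 1) θ) = ∫⁻ x, ∫⁻ y, F (append (x, y))
      ∂(iidKernel N (B.agentKernel (π.act h)) (θ, x)) ∂(B.histKernel π h θ) := by
  have e : B.histKernel π (h + 1) =
    (B.histKernel π h ⊗ₖ iidKernel N (B.agentKernel (π.act h))).map append := rfl
  rw [e, Kernel.lintegral_map _ measurable_append _ hF,
    Kernel.lintegral_compProd (f := fun q => F (append q)) _ _ _ (hF.comp measurable_append)]

/-- The expected regret of one agent in one round. -/
def roundRegret (ρ : ArgmaxRule S K) (h : ℕ) : ℝ :=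
  ∫ q, ∫ z, B.gap ρ q.1 z ∂(B.agentKernel (π.act h) q) ∂(B.jointLaw π h)

variable [Fintype S] [DiscreteMeasurableSpace S] {B}

lemma measurable_gap_hist (ρ : ArgmaxRule S K) {h : ℕ} (i : Fin h) (n : Fin N) :
    Measurable fun q : Θ × Hist S K N h => B.gap ρ q.1 (q.2 i n) :=
  (B.measurable_gap ρ).comp (f := fun q : Θ × Hist S K N h => (q.1, q.2 i n)) (by fun_prop)

lemma integral_gap_eval (ρ : ArgmaxRule S K) (h : ℕ) (n : Fin N) (q : Θ × Hist S K N h) :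
    ∫ y, B.gap ρ q.1 (y n) ∂(iidKernel N (B.agentKernel (π.act h)) q) =
      ∫ z, B.gap ρ q.1 z ∂(B.agentKernel (π.act h) q) :=
  integral_iidKernel_eval _ ((B.measurable_gap ρ).comp (measurable_const.prodMk measurable_id)) q n

/-- The summands do not involve `n`: only the marginal of one agent in each round matters, and all
marginals of the product kernel agree. -/
lemma Normalized.agentRegret_eq (hB : B.Normalized) (ρ : ArgmaxRule S K) (H : ℕ) (n : Fin N) :
    B.agentRegret ρ π H n = ∑ h ∈ Finset.range H, B.roundRegret π ρ h := by
  induction H with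
  | zero => simp [agentRegret]
  | succ H ih =>
    have hm : ∀ h : ℕ, Measurable fun q : Θ × Hist S K N h => ∑ i, B.gap ρ q.1 (q.2 i n) :=
      fun h => Finset.measurable_sum _ fun i _ => measurable_gap_hist ρ i n
    have hb : ∀ (h : ℕ) (q : Θ × Hist S K N h), |∑ i, B.gap ρ q.1 (q.2 i n)| ≤ h := fun h q =>
      (Finset.abs_sum_le_sum_abs _ _).trans
        ((Finset.sum_le_sum fun i _ => hB.abs_gap_le ρ _ _).trans (by simp))
    have hg : Measurable fun q : Θ × S × Fin K × ℝ => B.gap ρ q.1 q.2 := B.measurable_gap ρ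
    rw [Finset.sum_range_succ, ← ih, agentRegret, agentRegret, roundRegret]
    change ∫ q, _ ∂(B.jointLaw π (H + 1)) = ∫ q, _ ∂(B.jointLaw π H) + _
    rw [integral_jointLaw_succ B π (hm _) (hb _), ← integral_add
      (integrable_of_measurable_of_abs_le (hm _) (hb _))]
    · refine integral_congr_ae (ae_of_all _ fun q => ?_)
      simp only [Fin.sum_univ_castSucc, append_castSucc, append_last]
      rw [integral_add (integrable_const _), integral_gap_eval]
      · simp
      · exact integrable_of_measurable_of_abs_le
          (hg.comp (f := fun y : Round S K N => (q.1, y n)) (by fun_prop))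
          fun y => hB.abs_gap_le ρ _ _
    · refine integrable_of_measurable_of_abs_le (C := 1) ?_ fun q => ?_
      · have := StronglyMeasurable.integral_kernel_prod_right' (κ := B.agentKernel (π.act H))
          (f := fun p : (Θ × Hist S K N H) × (S × Fin K × ℝ) => B.gap ρ p.1.1 p.2)
          (hg.comp (by fun_prop : Measurable fun p : (Θ × Hist S K N H) × (S × Fin K × ℝ) =>
            (p.1.1, p.2))).stronglyMeasurable
        exact this.measurable
      · have := norm_integral_le_of_norm_le_const (μ := B.agentKernel (π.act H) q)
          (f := fun z => B.gap ρ q.1 z) (C := 1) (ae_of_all _ fun z => hB.abs_gap_le ρ q.1 z)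
        simpa using this

lemma Normalized.systemRegret_eq (hB : B.Normalized) (ρ : ArgmaxRule S K) (H : ℕ) :
    B.systemRegret ρ π H = N * ∑ h ∈ Finset.range H, B.roundRegret π ρ h := by
  have hm : ∀ n : Fin N, Measurable fun q : Θ × Hist S K N H => ∑ i, B.gap ρ q.1 (q.2 i n) :=
    fun n => Finset.measurable_sum _ fun i _ => measurable_gap_hist ρ i n
  have hb : ∀ (n : Fin N) (q : Θ × Hist S K N H), |∑ i, B.gap ρ q.1 (q.2 i n)| ≤ H := fun n q =>
    (Finset.abs_sum_le_sum_abs _ _).trans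
      ((Finset.sum_le_sum fun i _ => hB.abs_gap_le ρ _ _).trans (by simp))
  have : B.systemRegret ρ π H = ∑ n : Fin N, B.agentRegret ρ π H n := by
    simp only [systemRegret, agentRegret]
    rw [← integral_finsetSum _ fun n _ => integrable_of_measurable_of_abs_le (hm n) (hb n)]
    refine integral_congr_ae (ae_of_all _ fun q => ?_)
    exact Finset.sum_comm
  simp [this, hB.agentRegret_eq]

end Dynamics

end Bandit

/-! ### Pooled counts and reward sums -/

section Statistics

variable {S : Type*} {K N h : ℕ}

open Classical in
/-- The number of agents that meet the context-arm pair `p` in the round `y`. -/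
def roundCount (y : Round S K N) (p : S × Fin K) : ℕ :=
  ∑ n, if ((y n).1, (y n).2.1) = p then 1 else 0

/-- The number of times the context-arm pair `p` occurs in the history `x`. -/
def count (x : Hist S K N h) (p : S × Fin K) : ℕ := ∑ i, roundCount (x i) p

open Classical in
/-- The sum of the rewards of the context-arm pair `p` in the history `x`. -/
def total (x : Hist S K N h) (p : S × Fin K) : ℝ :=
  ∑ i, ∑ n, if ((x i n).1, (x i n).2.1) = p then (x i n).2.2 else 0

lemma count_append (x : Hist S K N h) (y : Round S K N) (p : S × Fin K) :
    count (Bandit.append (x, y)) p = count x p + roundCount y p := by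
  simp only [count, Fin.sum_univ_castSucc, Bandit.append_castSucc, Bandit.append_last]

lemma roundCount_le (y : Round S K N) (p : S × Fin K) : roundCount y p ≤ N := by
  refine (Finset.sum_le_sum (g := fun _ => 1) fun n _ => ?_).trans (by simp)
  split_ifs <;> simp

lemma sum_count [Fintype S] (x : Hist S K N h) : ∑ p, count x p = h * N := by
  classical
  have (i : Fin h) : ∑ p, roundCount (x i) p = N := by
    simp only [roundCount]
    rw [Finset.sum_comm]
    simp
  simp only [count]
  rw [Finset.sum_comm, Finset.sum_congr rfl fun i _ => this i]
  simp

lemma count_le (x : Hist S K N h) (p : S × Fin K) : count x p ≤ h * N := by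
  refine (Finset.sum_le_sum (g := fun _ => N) fun i _ => ?_).trans (by simp)
  exact roundCount_le (x i) p

lemma sum_eval_eq_sum_roundCount [Fintype S] (f : S × Fin K → ℝ) (y : Round S K N) :
    ∑ n, f ((y n).1, (y n).2.1) = ∑ p, roundCount y p * f p := by
  classical
  simp only [roundCount, Nat.cast_sum, Finset.sum_mul]
  rw [Finset.sum_comm]
  simp

variable [Fintype S] [MeasurableSpace S] [DiscreteMeasurableSpace S]

lemma measurableSet_obs (p : S × Fin K) :
    MeasurableSet {z : S × Fin K × ℝ | (z.1, z.2.1) = p} :=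
  (by fun_prop : Measurable fun z : S × Fin K × ℝ => (z.1, z.2.1)) (measurableSet_singleton p)

lemma measurableSet_obs_hist (p : S × Fin K) (i : Fin h) (n : Fin N) :
    MeasurableSet {x : Hist S K N h | ((x i n).1, (x i n).2.1) = p} :=
  (by fun_prop : Measurable fun x : Hist S K N h => x i n) (measurableSet_obs p)

@[fun_prop]
lemma measurable_count (p : S × Fin K) : Measurable fun x : Hist S K N h => count x p :=
  Finset.measurable_sum _ fun i _ => Finset.measurable_sum _ fun n _ =>
    Measurable.ite (measurableSet_obs_hist p i n) measurable_const measurable_const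

@[fun_prop]
lemma measurable_total (p : S × Fin K) : Measurable fun x : Hist S K N h => total x p :=
  Finset.measurable_sum _ fun i _ => Finset.measurable_sum _ fun n _ =>
    Measurable.ite (measurableSet_obs_hist p i n) (by fun_prop) measurable_const

end Statistics

/-! ### Concentration of reward sums around their means -/

namespace Bandit

variable {S Θ : Type*} [MeasurableSpace S] [MeasurableSpace Θ] {K N : ℕ} (B : Bandit S Θ K)

open Classical in
/-- The exponent of the contribution of one interaction to the exponential supermartingale of the
context-arm pair `p`. -/
def logWeight (θ : Θ) (p : S × Fin K) (l : ℝ) (z : S × Fin K × ℝ) : ℝ :=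
  if (z.1, z.2.1) = p then l * (z.2.2 - B.mean θ p.1 p.2) - l ^ 2 / 2 else 0

/-- The deviation of the sum of the observed rewards of `p` from its compensator. -/
def deviation {h : ℕ} (θ : Θ) (x : Hist S K N h) (p : S × Fin K) : ℝ :=
  total x p - count x p * B.mean θ p.1 p.2

lemma sum_logWeight {h : ℕ} (θ : Θ) (p : S × Fin K) (l : ℝ) (x : Hist S K N h) :
    ∑ i, ∑ n, B.logWeight θ p l (x i n) = l * B.deviation θ x p - l ^ 2 / 2 * count x p := by
  classical
  simp only [deviation, total, count, roundCount, Nat.cast_sum, Finset.sum_mul, Finset.mul_sum,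
    mul_sub, ← Finset.sum_sub_distrib]
  refine Finset.sum_congr rfl fun i _ => Finset.sum_congr rfl fun n _ => ?_
  unfold logWeight
  split_ifs
  · simp
    ring
  · simp

variable {B} in
-- The term `l ^ 2 / 2` cancels the sub-Gaussian bound on the moment generating function; an
-- observation of another pair has weight `1`.
lemma Normalized.lintegral_reward_logWeight_le (hB : B.Normalized) (θ : Θ) (p q : S × Fin K)
    (l : ℝ) :
    ∫⁻ r, ENNReal.ofReal (Real.exp (B.logWeight θ p l (q.1, q.2, r))) ∂(B.reward (θ, q.1, q.2))
      ≤ 1 := by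
  by_cases hpq : q = p
  · subst hpq
    have hs := (hB θ q.1 q.2).2
    have e (r : ℝ) : Real.exp (B.logWeight θ q l (q.1, q.2, r)) =
        Real.exp (l * (r - B.mean θ q.1 q.2)) * Real.exp (-(l ^ 2 / 2)) := by
      rw [← Real.exp_add]
      simp [logWeight, sub_eq_add_neg]
    simp only [e]
    rw [← ofReal_integral_eq_lintegral_ofReal ((hs.integrable_exp_mul l).mul_const _)
      (ae_of_all _ fun r => by positivity), integral_mul_const]
    refine ENNReal.ofReal_le_one.2 ?_
    have := hs.mgf_le l
    rw [mgf] at this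
    calc _ ≤ Real.exp (((1 : ℝ≥0) : ℝ) * l ^ 2 / 2) * Real.exp (-(l ^ 2 / 2)) := by gcongr
      _ = 1 := by rw [← Real.exp_add]; simp
  · simp [logWeight, hpq]

variable {B} in
lemma measurable_integral_act (π : Policy S K N) (h : ℕ)
    {f : Hist S K N h × S × Fin K → ℝ} (hf : Measurable f) :
    Measurable fun x => ∫ s, ∫ a, f (x, s, a) ∂(π.act h (x, s)) ∂B.ctx := by
  have h1 : StronglyMeasurable fun q : Hist S K N h × S => ∫ a, f (q.1, q.2, a) ∂(π.act h q) :=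
    StronglyMeasurable.integral_kernel_prod_right' (κ := π.act h)
      (f := fun p : (Hist S K N h × S) × Fin K => f (p.1.1, p.1.2, p.2))
      (hf.comp (by fun_prop)).stronglyMeasurable
  exact (h1.integral_prod_right' (ν := B.ctx)).measurable

variable [Fintype S] [DiscreteMeasurableSpace S]

@[fun_prop]
lemma measurable_logWeight (θ : Θ) (p : S × Fin K) (l : ℝ) : Measurable (B.logWeight θ p l) :=
  Measurable.ite (measurableSet_obs p) (by fun_prop) measurable_const

variable {B}

lemma Normalized.lintegral_agentKernel_logWeight_le (hB : B.Normalized) {h : ℕ}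
    (p : Kernel (Hist S K N h × S) (Fin K)) [IsMarkovKernel p] (θ : Θ) (x : Hist S K N h)
    (q : S × Fin K) (l : ℝ) :
    ∫⁻ z, ENNReal.ofReal (Real.exp (B.logWeight θ q l z)) ∂(B.agentKernel p (θ, x)) ≤ 1 := by
  have hm : Measurable fun z => ENNReal.ofReal (Real.exp (B.logWeight θ q l z)) := by fun_prop
  rw [agentKernel, Kernel.lintegral_compProd _ _ _ hm]
  refine (lintegral_mono fun s => ?_).trans (b := ∫⁻ _, 1 ∂B.ctx) (by simp)
  have hms : Measurable fun z : Fin K × ℝ =>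
      ENNReal.ofReal (Real.exp (B.logWeight θ q l (s, z))) := by fun_prop
  rw [Kernel.lintegral_compProd _ _ _ hms]
  refine (lintegral_mono (g := fun _ => 1) fun a => ?_).trans (by simp)
  exact hB.lintegral_reward_logWeight_le θ q (s, a) l

/-- Supermartingale property by induction on rounds: given the past, the new round multiplies the
weight by a product of `N` independent factors, each of mean at most `1`. Lower integrals avoid any
integrability question for the unbounded weights. -/
lemma Normalized.lintegral_histKernel_logWeight_le (hB : B.Normalized) (π : Policy S K N)
    (h : ℕ) (θ : Θ) (q : S × Fin K) (l : ℝ) :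
    ∫⁻ x, ENNReal.ofReal (Real.exp (∑ i, ∑ n, B.logWeight θ q l (x i n)))
      ∂(B.histKernel π h θ) ≤ 1 := by
  induction h with
  | zero => simp
  | succ h ih =>
    have hg : Measurable fun z => ENNReal.ofReal (Real.exp (B.logWeight θ q l z)) := by fun_prop
    rw [lintegral_histKernel_succ B π (by fun_prop)]
    refine (lintegral_mono fun x => ?_).trans ih
    simp only [Fin.sum_univ_castSucc, append_castSucc, append_last, Real.exp_add, Real.exp_sum]
    simp only [ENNReal.ofReal_mul (Finset.prod_nonneg fun _ _ =>
      Finset.prod_nonneg fun _ _ => (Real.exp_pos _).le),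
      ENNReal.ofReal_prod_of_nonneg fun _ _ => (Real.exp_pos _).le]
    rw [lintegral_const_mul _ (by fun_prop), lintegral_iidKernel_prod _ hg]
    exact mul_le_of_le_one_right' (pow_le_one₀ (by simp)
      (hB.lintegral_agentKernel_logWeight_le _ θ x q l))

variable (B)

/-- The event that the reward sum of `p` deviates, in the direction of the sign `σ`, by more than
`c` times the square root of the number of observations. -/
def deviationEvent (h : ℕ) (σ c : ℝ) (p : S × Fin K) : Set (Θ × Hist S K N h) :=
  {q | 1 ≤ count q.2 p ∧ c * √(count q.2 p) < σ * B.deviation q.1 q.2 p}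

@[fun_prop]
lemma measurable_deviation {h : ℕ} (p : S × Fin K) :
    Measurable fun q : Θ × Hist S K N h => B.deviation q.1 q.2 p := by
  unfold deviation
  have h1 : Measurable fun q : Θ × Hist S K N h => count q.2 p :=
    (measurable_count p).comp measurable_snd
  have h2 : Measurable fun q : Θ × Hist S K N h => total q.2 p :=
    (measurable_total p).comp measurable_snd
  have h3 : Measurable fun q : Θ × Hist S K N h => (count q.2 p : ℝ) :=
    measurable_from_nat.comp h1
  fun_prop

lemma measurableSet_deviationEvent (h : ℕ) (σ c : ℝ) (p : S × Fin K) :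
    MeasurableSet (B.deviationEvent (N := N) h σ c p) := by
  have h1 : Measurable fun q : Θ × Hist S K N h => count q.2 p :=
    (measurable_count p).comp measurable_snd
  have h3 : Measurable fun q : Θ × Hist S K N h => (count q.2 p : ℝ) :=
    measurable_from_nat.comp h1
  exact (measurableSet_le measurable_const h1).inter
    (measurableSet_lt (h3.sqrt.const_mul c) ((B.measurable_deviation p).const_mul σ))

variable {B}

/-- The best exponent `l = σ c / √m` depends on the count `m`, which is random. Summing the weights
over all possible `m` costs the factor `T`. -/
lemma Normalized.jointLaw_deviationEvent_le (hB : B.Normalized) (π : Policy S K N) {h T : ℕ}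
    (hT : h * N ≤ T) {σ c : ℝ} (hσ : σ ^ 2 = 1) (hc : 0 ≤ c) (p : S × Fin K) :
    B.jointLaw π h (B.deviationEvent h σ c p) ≤ ENNReal.ofReal (T * Real.exp (-(c ^ 2 / 2))) := by
  have hE := B.measurableSet_deviationEvent (N := N) h σ c p
  rw [jointLaw, Measure.compProd_apply hE]
  refine (lintegral_mono (g := fun _ => ENNReal.ofReal (T * Real.exp (-(c ^ 2 / 2))))
    fun θ => ?_).trans (by simp)
  set W : ℕ → Hist S K N h → ℝ≥0∞ := fun m x =>
    ENNReal.ofReal (Real.exp (∑ i, ∑ n, B.logWeight θ p (σ * c / √m) (x i n)))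
  have hW : ∀ m, Measurable (W m) := fun m => by fun_prop
  -- On the event with count `m`, the exponent of `W m` is at least `c ^ 2 - c ^ 2 / 2`, so this
  -- single term of the sum already reaches `1` after scaling.
  have key : ∀ x, (Prod.mk θ ⁻¹' B.deviationEvent h σ c p).indicator 1 x ≤
      ENNReal.ofReal (Real.exp (-(c ^ 2 / 2))) * ∑ m ∈ Finset.Icc 1 T, W m x := by
    intro x
    refine Set.indicator_apply_le' (fun hx => ?_) fun _ => zero_le
    obtain ⟨h1, h2⟩ := hx
    set m := count x p with hm
    have hmT : m ∈ Finset.Icc 1 T := Finset.mem_Icc.2 ⟨h1, (count_le x p).trans hT⟩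
    refine le_trans ?_ (mul_le_mul_right
      (Finset.single_le_sum (f := fun m => W m x) (fun _ _ => zero_le) hmT) _)
    rw [← ENNReal.ofReal_mul (Real.exp_pos _).le, ← Real.exp_add, sum_logWeight, ← hm,
      Pi.one_apply, ENNReal.one_le_ofReal]
    refine Real.one_le_exp ?_
    have hpos : (0 : ℝ) < √m := Real.sqrt_pos.2 (by exact_mod_cast h1)
    have hsq : √(m : ℝ) ^ 2 = m := Real.sq_sqrt (Nat.cast_nonneg m)
    have e1 : (σ * c / √m) ^ 2 / 2 * m = c ^ 2 / 2 := by
      rw [div_pow, mul_pow, hσ, hsq]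
      have : (m : ℝ) ≠ 0 := by positivity
      field_simp
    have e2 : c ^ 2 ≤ σ * c / √m * B.deviation θ x p := by
      rw [div_mul_eq_mul_div, le_div_iff₀ hpos]
      have := mul_le_mul_of_nonneg_left h2.le hc
      simp only at this
      nlinarith
    rw [e1]
    linarith
  calc B.histKernel π h θ (Prod.mk θ ⁻¹' B.deviationEvent h σ c p)
      = ∫⁻ x, (Prod.mk θ ⁻¹' B.deviationEvent h σ c p).indicator 1 x ∂(B.histKernel π h θ) :=
        (lintegral_indicator_one (measurable_prodMk_left hE)).symm
    _ ≤ ∫⁻ x, ENNReal.ofReal (Real.exp (-(c ^ 2 / 2))) * ∑ m ∈ Finset.Icc 1 T, W m x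
          ∂(B.histKernel π h θ) := lintegral_mono key
    _ = ENNReal.ofReal (Real.exp (-(c ^ 2 / 2))) *
          ∑ m ∈ Finset.Icc 1 T, ∫⁻ x, W m x ∂(B.histKernel π h θ) := by
        rw [lintegral_const_mul _ (Finset.measurable_sum _ fun m _ => hW m),
          lintegral_finsetSum _ fun m _ => hW m]
    _ ≤ ENNReal.ofReal (Real.exp (-(c ^ 2 / 2))) * ∑ m ∈ Finset.Icc 1 T, 1 := by
        gcongr with m hm
        exact hB.lintegral_histKernel_logWeight_le π h θ p _
    _ = ENNReal.ofReal (T * Real.exp (-(c ^ 2 / 2))) := by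
        rw [mul_comm (T : ℝ), ENNReal.ofReal_mul (Real.exp_pos _).le]
        simp

variable (B) in
/-- The event that the reward sum of some context-arm pair deviates in the direction `σ`. -/
def badEvent (h : ℕ) (σ c : ℝ) : Set (Θ × Hist S K N h) := ⋃ p, B.deviationEvent h σ c p

lemma measurableSet_badEvent (h : ℕ) (σ c : ℝ) :
    MeasurableSet (B.badEvent (N := N) h σ c) :=
  MeasurableSet.iUnion fun p => B.measurableSet_deviationEvent h σ c p

lemma Normalized.jointLaw_badEvent_le (hB : B.Normalized) (π : Policy S K N) {h T : ℕ}
    (hT : h * N ≤ T) {σ c : ℝ} (hσ : σ ^ 2 = 1) (hc : 0 ≤ c) :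
    (B.jointLaw π h).real (B.badEvent h σ c) ≤
      K * Fintype.card S * (T * Real.exp (-(c ^ 2 / 2))) := by
  refine (measureReal_iUnion_fintype_le _).trans ?_
  refine (Finset.sum_le_sum fun p _ => ENNReal.toReal_le_of_le_ofReal (by positivity)
    (hB.jointLaw_deviationEvent_le π hT hσ hc p)).trans ?_
  simp
  linarith

/-! ### Posterior sampling -/

lemma integral_agentKernel_ctx_arm {h : ℕ} (p : Kernel (Hist S K N h × S) (Fin K))
    [IsMarkovKernel p] (q : Θ × Hist S K N h) {f : S × Fin K → ℝ} {C : ℝ} (hC : ∀ y, |f y| ≤ C) :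
    ∫ z, f (z.1, z.2.1) ∂(B.agentKernel p q) = ∫ s, ∫ a, f (s, a) ∂(p (q.2, s)) ∂B.ctx := by
  have hf : Measurable f := measurable_of_countable f
  rw [agentKernel, ProbabilityTheory.integral_compProd
    (integrable_of_measurable_of_abs_le (C := C) (by fun_prop) fun z => hC _)]
  simp only [Kernel.const_apply]
  refine integral_congr_ae (ae_of_all _ fun s => ?_)
  simp only
  rw [ProbabilityTheory.integral_compProd
    (integrable_of_measurable_of_abs_le (C := C) (by fun_prop) fun z => hC _)]
  simp [Kernel.comap_apply]

/-- Given the past, the arm played by Thompson sampling is distributed as the optimal arm. -/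
lemma IsThompsonSampling.integral_arm_eq_integral_bestArm [StandardBorelSpace Θ] [Nonempty Θ]
    {ρ : ArgmaxRule S K} {π : Policy S K N} (hπ : B.IsThompsonSampling ρ π) (h : ℕ)
    {f : Hist S K N h × S × Fin K → ℝ} (hf : Measurable f) {C : ℝ} (hC : ∀ y, |f y| ≤ C) :
    ∫ q, ∫ z, f (q.2, z.1, z.2.1) ∂(B.agentKernel (π.act h) q) ∂(B.jointLaw π h) =
      ∫ q, ∫ z, f (q.2, z.1, ρ.pick z.1 (B.mean q.1 z.1))
        ∂(B.agentKernel (π.act h) q) ∂(B.jointLaw π h) := by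
  have hbest : Measurable fun q : (Hist S K N h × Θ) × S =>
      f (q.1.1, q.2, ρ.pick q.2 (B.mean q.1.2 q.2)) := by
    have := (B.measurable_bestArm ρ).comp
      (f := fun q : (Hist S K N h × Θ) × S => (q.1.2, q.2)) (by fun_prop)
    exact hf.comp (measurable_fst.fst.prodMk (measurable_snd.prodMk this))
  have hG := measurable_integral_act (B := B) π h hf
  have eR (q : Θ × Hist S K N h) : ∫ z, f (q.2, z.1, ρ.pick z.1 (B.mean q.1 z.1))
      ∂(B.agentKernel (π.act h) q) = ∫ s, f (q.2, s, ρ.pick s (B.mean q.1 s)) ∂B.ctx := by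
    rw [integral_agentKernel_ctx_arm (π.act h) q
      (f := fun y => f (q.2, y.1, ρ.pick y.1 (B.mean q.1 y.1))) fun _ => hC _]
    simp
  have eL (q : Θ × Hist S K N h) : ∫ z, f (q.2, z.1, z.2.1) ∂(B.agentKernel (π.act h) q) =
      ∫ s, ∫ a, f (q.2, s, a) ∂(π.act h (q.2, s)) ∂B.ctx :=
    integral_agentKernel_ctx_arm (π.act h) q (f := fun y => f (q.2, y)) fun _ => hC _
  simp only [eL, eR]
  have hpost : ∀ᵐ x ∂(B.histKernel π h ∘ₘ B.prior),
      ∫ s, ∫ a, f (x, s, a) ∂(π.act h (x, s)) ∂B.ctx =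
        ∫ θ, ∫ s, f (x, s, ρ.pick s (B.mean θ s)) ∂B.ctx
          ∂(posterior (B.histKernel π h) B.prior x) := by
    filter_upwards [hπ h] with x hx
    -- With the context outermost, each fixed `s` compares the played arm with the maximiser under
    -- the posterior; these have the same law by definition of `sampleArm`.
    rw [integral_integral_swap]
    · refine integral_congr_ae (ae_of_all _ fun s => ?_)
      simp only [hx s, sampleArm]
      rw [integral_map (f := fun a => f (x, s, a)) (ρ.measurable_pick s).aemeasurable
          (hf.comp (by fun_prop : Measurable fun a => (x, s, a))).aestronglyMeasurable,
        integral_map (B.measurable_mean_vec s).aemeasurable]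
      exact (hf.comp ((measurable_const (a := x)).prodMk ((measurable_const (a := s)).prodMk
        (ρ.measurable_pick s)))).aestronglyMeasurable
    · exact integrable_of_measurable_of_abs_le (C := C)
        (hbest.comp (f := fun q : Θ × S => ((x, q.1), q.2)) (by fun_prop)) fun _ => hC _
  have hI : StronglyMeasurable fun q : Hist S K N h × Θ =>
      ∫ s, f (q.1, s, ρ.pick s (B.mean q.2 s)) ∂B.ctx :=
    hbest.stronglyMeasurable.integral_prod_right' (ν := B.ctx)
  have hIC (q : Hist S K N h × Θ) : |∫ s, f (q.1, s, ρ.pick s (B.mean q.2 s)) ∂B.ctx| ≤ C := by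
    simpa using norm_integral_le_of_norm_le_const (μ := B.ctx)
      (f := fun s => f (q.1, s, ρ.pick s (B.mean q.2 s))) (C := C) (ae_of_all _ fun s => hC _)
  calc ∫ q, ∫ s, ∫ a, f (q.2, s, a) ∂(π.act h (q.2, s)) ∂B.ctx ∂(B.jointLaw π h)
      = ∫ x, ∫ s, ∫ a, f (x, s, a) ∂(π.act h (x, s)) ∂B.ctx
          ∂(B.histKernel π h ∘ₘ B.prior) := by
        rw [← Measure.snd_compProd, Measure.snd, integral_map measurable_snd.aemeasurable
          hG.aestronglyMeasurable]
        rfl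
    _ = ∫ x, ∫ θ, ∫ s, f (x, s, ρ.pick s (B.mean θ s)) ∂B.ctx
          ∂(posterior (B.histKernel π h) B.prior x) ∂(B.histKernel π h ∘ₘ B.prior) :=
        integral_congr_ae hpost
    _ = ∫ q : Hist S K N h × Θ, ∫ s, f (q.1, s, ρ.pick s (B.mean q.2 s)) ∂B.ctx
          ∂((B.histKernel π h ∘ₘ B.prior) ⊗ₘ posterior (B.histKernel π h) B.prior) := by
        rw [Measure.integral_compProd
          (integrable_of_measurable_of_abs_le hI.measurable hIC)]
    _ = ∫ q, ∫ s, f (q.2, s, ρ.pick s (B.mean q.1 s)) ∂B.ctx ∂(B.jointLaw π h) := by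
        -- Bayes' rule: drawing the history and then the instance from the posterior recovers the
        -- joint law.
        rw [compProd_posterior_eq_map_swap, integral_map measurable_swap.aemeasurable
          hI.aestronglyMeasurable]
        rfl

end Bandit

/-! ### Confidence widths and the potential argument -/

section Potential

/-- The width of the confidence interval after `n` observations; it is trivial as long as there are
fewer observations than agents. -/
def width (N : ℕ) (c : ℝ) (n : ℕ) : ℝ := if n < N then 1 else 2 * c / √n

/-- The upper end of the confidence interval after `n` observations with sum `t`, clipped to
`[0, 1]`. -/
def upperBound (N : ℕ) (c : ℝ) (n : ℕ) (t : ℝ) : ℝ :=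
  if n < N then 1 else max 0 (min 1 (t / n + c / √n))

/-- A potential whose increments dominate the confidence widths accumulated in one round. -/
def potential (N : ℕ) (c : ℝ) (n : ℕ) : ℝ := min (n : ℝ) (2 * N - 1) + 4 * c * √((n : ℝ) - N)

variable {N : ℕ} {c : ℝ}

lemma abs_width_le (hN : 1 ≤ N) (hc : 0 ≤ c) (n : ℕ) : |width N c n| ≤ 1 + 2 * c := by
  unfold width
  split_ifs with h
  · simpa using hc
  · have h1 : (1 : ℝ) ≤ √n := Real.one_le_sqrt.2 (by exact_mod_cast hN.trans (not_lt.1 h))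
    rw [abs_of_nonneg (by positivity)]
    exact (div_le_self (by positivity) h1).trans (by linarith)

lemma abs_upperBound_le (n : ℕ) (t : ℝ) : |upperBound N c n t| ≤ 1 := by
  unfold upperBound
  split_ifs
  · simp
  · rw [abs_of_nonneg (le_max_left _ _)]
    exact max_le zero_le_one (min_le_left _ _)

lemma sub_upperBound_le_zero (hN : 1 ≤ N) {n : ℕ} {t m : ℝ} (hm : m ≤ 1)
    (h : 1 ≤ n → n * m - t ≤ c * √n) : m - upperBound N c n t ≤ 0 := by
  unfold upperBound
  split_ifs with hn
  · linarith
  · have hn1 : 1 ≤ n := hN.trans (not_lt.1 hn)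
    have hpos : (0 : ℝ) < n := by exact_mod_cast hn1
    have hs := Real.mul_self_sqrt hpos.le
    have hsp := Real.sqrt_pos.2 hpos
    have e : c / √(n : ℝ) = c * √n / n := by
      rw [div_eq_div_iff hsp.ne' hpos.ne']
      linear_combination (-c) * hs
    have : m ≤ t / n + c / √n := by
      rw [e, ← add_div, le_div_iff₀ hpos]
      linarith [h hn1]
    linarith [le_max_right 0 (min 1 (t / n + c / √n)), le_min hm this]

lemma upperBound_sub_le_width (hN : 1 ≤ N) (hc : 0 ≤ c) {n : ℕ} {t m : ℝ} (hm : 0 ≤ m)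
    (h : 1 ≤ n → t - n * m ≤ c * √n) : upperBound N c n t - m ≤ width N c n := by
  unfold upperBound width
  split_ifs with hn
  · linarith
  · have hn1 : 1 ≤ n := hN.trans (not_lt.1 hn)
    have hpos : (0 : ℝ) < n := by exact_mod_cast hn1
    have hs := Real.mul_self_sqrt hpos.le
    have hsp := Real.sqrt_pos.2 hpos
    have e : c / √(n : ℝ) = c * √n / n := by
      rw [div_eq_div_iff hsp.ne' hpos.ne']
      linear_combination (-c) * hs
    have h1 : t / n ≤ m + c / √n := by
      rw [e, div_le_iff₀ hpos, add_mul, div_mul_cancel₀ _ hpos.ne']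
      linarith [h hn1]
    have h2 : 0 ≤ c / √(n : ℝ) := by positivity
    have e2 : 2 * c / √(n : ℝ) = 2 * (c / √n) := mul_div_assoc _ _ _
    rw [e2, sub_le_iff_le_add]
    exact max_le (by linarith) ((min_le_right _ _).trans (by linarith))

/-- All `b` plays in a round are charged the width at the count `n` before the round. Shifting the
square root by `N` keeps its argument at most `n` even after the round, so its slope stays above
that of `√` at `n`. -/
lemma mul_width_le_potential_sub (hN : 1 ≤ N) (hc : 0 ≤ c) {b : ℕ} (hb : b ≤ N) (n : ℕ) :
    b * width N c n ≤ potential N c (n + b) - potential N c n := by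
  have hN' : (1 : ℝ) ≤ N := by exact_mod_cast hN
  have hb' : (b : ℝ) ≤ N := by exact_mod_cast hb
  have hb0 : (0 : ℝ) ≤ b := Nat.cast_nonneg b
  have hmono : √((n : ℝ) - N) ≤ √((n : ℝ) + b - N) := Real.sqrt_le_sqrt (by linarith)
  unfold width potential
  push_cast
  split_ifs with h
  · have hn : (n : ℝ) + 1 ≤ N := by exact_mod_cast h
    -- Here `n ≤ N - 1` and `b ≤ N`, so `n + b ≤ 2 * N - 1` and the cap is inactive: the first term
    -- grows by exactly `b`.
    rw [min_eq_left (by linarith), min_eq_left (by linarith)]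
    have := mul_le_mul_of_nonneg_left hmono (by positivity : 0 ≤ 4 * c)
    linarith
  · have hn : (N : ℝ) ≤ n := by exact_mod_cast not_lt.1 h
    have hmin : min (n : ℝ) (2 * N - 1) ≤ min ((n : ℝ) + b) (2 * N - 1) :=
      min_le_min_right _ (by linarith)
    have hsp : 0 < √(n : ℝ) := Real.sqrt_pos.2 (by linarith)
    have hu := Real.sq_sqrt (by linarith : 0 ≤ (n : ℝ) - N)
    have hv := Real.sq_sqrt (by linarith : 0 ≤ (n : ℝ) + b - N)
    have hu' : √((n : ℝ) - N) ≤ √n := Real.sqrt_le_sqrt (by linarith)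
    have hv' : √((n : ℝ) + b - N) ≤ √n := Real.sqrt_le_sqrt (by linarith)
    set u := √((n : ℝ) - N)
    set v := √((n : ℝ) + b - N)
    have hd : 0 ≤ v - u := sub_nonneg.2 hmono
    have key : (b : ℝ) / √n ≤ 2 * (v - u) := by
      rw [div_le_iff₀ hsp]
      -- `b = (v - u) * (v + u)` with both `u` and `v` at most `√n`.
      nlinarith
    have e : (b : ℝ) * (2 * c / √n) = 2 * c * (b / √n) := by ring
    rw [e]
    have := mul_le_mul_of_nonneg_left key (by positivity : 0 ≤ 2 * c)
    linarith

lemma potential_nonneg (hN : 1 ≤ N) (hc : 0 ≤ c) (n : ℕ) : 0 ≤ potential N c n := by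
  have hN' : (1 : ℝ) ≤ N := by exact_mod_cast hN
  have : 0 ≤ min (n : ℝ) (2 * N - 1) := le_min (Nat.cast_nonneg n) (by linarith)
  unfold potential
  positivity

lemma potential_le (hc : 0 ≤ c) (n : ℕ) : potential N c n ≤ (2 * N - 1) + 4 * c * √n := by
  unfold potential
  have h : √((n : ℝ) - N) ≤ √n := Real.sqrt_le_sqrt (by linarith [N.cast_nonneg (α := ℝ)])
  gcongr
  exact min_le_right _ _

variable {S : Type*} [Fintype S] {K h : ℕ}

/-- The sum of the potentials of all context-arm pairs. -/
def totalPotential (c : ℝ) (x : Hist S K N h) : ℝ := ∑ p, potential N c (count x p)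

lemma sum_width_le_totalPotential_sub (hN : 1 ≤ N) (hc : 0 ≤ c) (x : Hist S K N h)
    (y : Round S K N) :
    ∑ n, width N c (count x ((y n).1, (y n).2.1)) ≤
      totalPotential c (Bandit.append (x, y)) - totalPotential c x := by
  rw [sum_eval_eq_sum_roundCount (fun p => width N c (count x p)) y, totalPotential,
    totalPotential, ← Finset.sum_sub_distrib]
  refine Finset.sum_le_sum fun p _ => ?_
  rw [count_append]
  exact mul_width_le_potential_sub hN hc (roundCount_le y p) _

lemma totalPotential_nonneg (hN : 1 ≤ N) (hc : 0 ≤ c) (x : Hist S K N h) :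
    0 ≤ totalPotential c x :=
  Finset.sum_nonneg fun _ _ => potential_nonneg hN hc _

lemma totalPotential_le (hc : 0 ≤ c) (x : Hist S K N h) :
    totalPotential c x ≤
      K * Fintype.card S * (2 * N - 1) + 4 * c * √(K * Fintype.card S * (h * N)) := by
  have h1 : ∑ p, √(count x p : ℝ) ≤ √(K * Fintype.card S * (h * N)) := by
    -- Cauchy-Schwarz over the `K|S|` pairs, whose counts add up to `h * N`.
    refine Real.le_sqrt_of_sq_le (sq_sum_le_card_mul_sum_sq.trans (le_of_eq ?_))
    have : ∑ p, (count x p : ℝ) = h * N := by exact_mod_cast sum_count x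
    simp only [Real.sq_sqrt (Nat.cast_nonneg _), this]
    simp [mul_comm]
  calc totalPotential c x ≤ ∑ p : S × Fin K, ((2 * N - 1) + 4 * c * √(count x p)) :=
        Finset.sum_le_sum fun p _ => potential_le hc _
    _ = K * Fintype.card S * (2 * N - 1) + 4 * c * ∑ p, √(count x p : ℝ) := by
        rw [Finset.sum_add_distrib, ← Finset.mul_sum]
        simp
        ring
    _ ≤ _ := by gcongr

lemma abs_totalPotential_le (hN : 1 ≤ N) (hc : 0 ≤ c) (x : Hist S K N h) :
    |totalPotential c x| ≤
      K * Fintype.card S * (2 * N - 1) + 4 * c * √(K * Fintype.card S * (h * N)) := by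
  rw [abs_of_nonneg (totalPotential_nonneg hN hc x)]
  exact totalPotential_le hc x

lemma measurable_totalPotential [MeasurableSpace S] [DiscreteMeasurableSpace S] (c : ℝ) :
    Measurable fun x : Hist S K N h => totalPotential c x :=
  Finset.measurable_sum _ fun p _ =>
    (measurable_from_nat (f := potential N c)).comp (measurable_count p)

end Potential

/-! ### Regret decomposition and summation over rounds -/

namespace Bandit

variable {S Θ : Type*} [MeasurableSpace S] [MeasurableSpace Θ] {K N : ℕ} {B : Bandit S Θ K}

/-- Sums that are too low (`σ = -1`) can spoil optimism at the optimal arm, and sums that are too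
high (`σ = 1`) the width at the played arm. Since means and bounds lie in `[0, 1]`, each failure
costs at most `1`. -/
lemma Normalized.gap_le (hB : B.Normalized) (ρ : ArgmaxRule S K) (hN : 1 ≤ N) {c : ℝ}
    (hc : 0 ≤ c) {h : ℕ} (θ : Θ) (x : Hist S K N h) (z : S × Fin K × ℝ) :
    B.gap ρ θ z ≤ (B.badEvent h (-1) c).indicator 1 (θ, x) + (B.badEvent h 1 c).indicator 1 (θ, x)
      + width N c (count x (z.1, z.2.1))
      + (upperBound N c (count x (z.1, ρ.pick z.1 (B.mean θ z.1)))
            (total x (z.1, ρ.pick z.1 (B.mean θ z.1)))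
          - upperBound N c (count x (z.1, z.2.1)) (total x (z.1, z.2.1))) := by
  have hlow (a : Fin K) : B.mean θ z.1 a - upperBound N c (count x (z.1, a)) (total x (z.1, a)) ≤
      (B.badEvent h (-1) c).indicator 1 (θ, x) := by
    obtain ⟨hm0, hm1⟩ := (hB θ z.1 a).1
    by_cases hbad : (θ, x) ∈ B.badEvent h (-1) c
    · rw [Set.indicator_of_mem hbad, Pi.one_apply]
      have : 0 ≤ upperBound N c (count x (z.1, a)) (total x (z.1, a)) := by
        unfold upperBound
        split_ifs
        exacts [zero_le_one, le_max_left _ _]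
      linarith
    · rw [Set.indicator_of_notMem hbad]
      refine sub_upperBound_le_zero hN hm1 fun hn => not_lt.1 fun hlt => hbad ?_
      refine Set.mem_iUnion.2 ⟨(z.1, a), hn, ?_⟩
      simp only [deviation]
      linarith
  have hup (a : Fin K) : upperBound N c (count x (z.1, a)) (total x (z.1, a)) - B.mean θ z.1 a ≤
      width N c (count x (z.1, a)) + (B.badEvent h 1 c).indicator 1 (θ, x) := by
    obtain ⟨hm0, hm1⟩ := (hB θ z.1 a).1
    by_cases hbad : (θ, x) ∈ B.badEvent h 1 c
    · rw [Set.indicator_of_mem hbad, Pi.one_apply]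
      have h1 := (abs_le.1 (abs_upperBound_le (N := N) (c := c) (count x (z.1, a))
        (total x (z.1, a)))).2
      have h2 : 0 ≤ width N c (count x (z.1, a)) := by
        unfold width
        split_ifs <;> positivity
      linarith
    · rw [Set.indicator_of_notMem hbad, add_zero]
      refine upperBound_sub_le_width hN hc hm0 fun hn => not_lt.1 fun hlt => hbad ?_
      refine Set.mem_iUnion.2 ⟨(z.1, a), hn, ?_⟩
      simp only [deviation]
      linarith
  have h1 := hlow (ρ.pick z.1 (B.mean θ z.1))
  have h2 := hup z.2.1
  rw [gap]
  linarith

/-- The joint law of the instance, the past and one interaction of one agent in round `h`. -/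
def interactionLaw (B : Bandit S Θ K) (π : Policy S K N) (h : ℕ) :
    Measure ((Θ × Hist S K N h) × (S × Fin K × ℝ)) :=
  B.jointLaw π h ⊗ₘ B.agentKernel (π.act h)

instance (π : Policy S K N) (h : ℕ) : IsProbabilityMeasure (B.interactionLaw π h) := by
  unfold interactionLaw; infer_instance

lemma integral_interactionLaw (π : Policy S K N) (h : ℕ)
    {F : (Θ × Hist S K N h) × (S × Fin K × ℝ) → ℝ} (hF : Measurable F) {C : ℝ}
    (hC : ∀ w, |F w| ≤ C) :
    ∫ w, F w ∂(B.interactionLaw π h) =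
      ∫ q, ∫ z, F (q, z) ∂(B.agentKernel (π.act h) q) ∂(B.jointLaw π h) :=
  Measure.integral_compProd (integrable_of_measurable_of_abs_le hF hC)

variable [Fintype S]

lemma integral_totalPotential_le (π : Policy S K N) (hN : 1 ≤ N) {c : ℝ} (hc : 0 ≤ c) (h : ℕ) :
    ∫ q, totalPotential c q.2 ∂(B.jointLaw π h) ≤
      K * Fintype.card S * (2 * N - 1) + 4 * c * √(K * Fintype.card S * (h * N)) := by
  have h1 := integral_mono_of_nonneg (μ := B.jointLaw π h) (f := fun q => totalPotential c q.2)
    (g := fun _ => K * Fintype.card S * (2 * N - 1) + 4 * c * √(K * Fintype.card S * (h * N)))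
    (ae_of_all _ fun q => totalPotential_nonneg hN hc q.2)
    (integrable_const _) (ae_of_all _ fun q => totalPotential_le hc q.2)
  rwa [integral_const, probReal_univ, one_smul] at h1

variable [DiscreteMeasurableSpace S]

lemma measurable_width (c : ℝ) {h : ℕ} :
    Measurable fun y : Hist S K N h × S × Fin K => width N c (count y.1 y.2) :=
  measurable_from_prod_countable_left fun p =>
    (measurable_from_nat (f := width N c)).comp (measurable_count p)

lemma measurable_upperBound (c : ℝ) {h : ℕ} :
    Measurable fun y : Hist S K N h × S × Fin K =>
      upperBound N c (count y.1 y.2) (total y.1 y.2) := by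
  refine measurable_from_prod_countable_left fun p => ?_
  have h1 : Measurable fun x : Hist S K N h => (count x p : ℝ) :=
    measurable_from_nat.comp (measurable_count p)
  exact Measurable.ite (measurableSet_lt (measurable_count p) measurable_const)
    measurable_const (measurable_const.max (measurable_const.min
      (((measurable_total p).div h1).add (measurable_const.div h1.sqrt))))

lemma measurable_width_interaction (c : ℝ) (h : ℕ) :
    Measurable fun w : (Θ × Hist S K N h) × (S × Fin K × ℝ) =>
      width N c (count w.1.2 (w.2.1, w.2.2.1)) :=
  (measurable_width c).comp (f := fun w : (Θ × Hist S K N h) × (S × Fin K × ℝ) =>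
    (w.1.2, w.2.1, w.2.2.1)) (by fun_prop)

lemma IsThompsonSampling.roundRegret_le [StandardBorelSpace Θ] [Nonempty Θ] (hB : B.Normalized)
    {ρ : ArgmaxRule S K} {π : Policy S K N} (hπ : B.IsThompsonSampling ρ π) (hN : 1 ≤ N)
    {c : ℝ} (hc : 0 ≤ c) {h T : ℕ} (hT : h * N ≤ T) :
    B.roundRegret π ρ h ≤ 2 * (K * Fintype.card S * (T * Real.exp (-(c ^ 2 / 2)))) +
      ∫ w, width N c (count w.1.2 (w.2.1, w.2.2.1)) ∂(B.interactionLaw π h) := by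
  have hgap : Measurable fun w : (Θ × Hist S K N h) × (S × Fin K × ℝ) => B.gap ρ w.1.1 w.2 :=
    (B.measurable_gap ρ).comp (f := fun w : (Θ × Hist S K N h) × (S × Fin K × ℝ) =>
      (w.1.1, w.2)) (by fun_prop)
  have hwid := measurable_width_interaction (Θ := Θ) (S := S) (K := K) (N := N) c h
  set U : Hist S K N h × S × Fin K → ℝ :=
    fun y => upperBound N c (count y.1 y.2) (total y.1 y.2)
  have hU : Measurable U := measurable_upperBound c
  have hUb : ∀ y, |U y| ≤ 1 := fun y => abs_upperBound_le _ _
  have hUA : Measurable fun w : (Θ × Hist S K N h) × (S × Fin K × ℝ) =>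
      U (w.1.2, w.2.1, w.2.2.1) := hU.comp (by fun_prop)
  have hUB : Measurable fun w : (Θ × Hist S K N h) × (S × Fin K × ℝ) =>
      U (w.1.2, w.2.1, ρ.pick w.2.1 (B.mean w.1.1 w.2.1)) :=
    hU.comp (measurable_fst.snd.prodMk (measurable_snd.fst.prodMk
      ((B.measurable_bestArm ρ).comp (measurable_fst.fst.prodMk measurable_snd.fst))))
  have hI (σ : ℝ) : Measurable fun w : (Θ × Hist S K N h) × (S × Fin K × ℝ) =>
      (B.badEvent h σ c).indicator (1 : Θ × Hist S K N h → ℝ) w.1 :=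
    (measurable_one.indicator (measurableSet_badEvent h σ c)).comp measurable_fst
  have hIb (σ : ℝ) (w : (Θ × Hist S K N h) × (S × Fin K × ℝ)) :
      |(B.badEvent h σ c).indicator (1 : Θ × Hist S K N h → ℝ) w.1| ≤ 1 := by
    by_cases hw : w.1 ∈ B.badEvent h σ c <;> simp [hw]
  have hIint (σ : ℝ) (hσ : σ ^ 2 = 1) :
      ∫ w, (B.badEvent h σ c).indicator (1 : Θ × Hist S K N h → ℝ) w.1 ∂(B.interactionLaw π h) ≤
        K * Fintype.card S * (T * Real.exp (-(c ^ 2 / 2))) := by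
    rw [integral_interactionLaw π h (hI σ) (hIb σ)]
    simp only [integral_const, probReal_univ, one_smul]
    rw [integral_indicator_one (measurableSet_badEvent h σ c)]
    exact hB.jointLaw_badEvent_le π hT hσ hc
  have iI := fun σ => integrable_of_measurable_of_abs_le (μ := B.interactionLaw π h) (hI σ) (hIb σ)
  have iW := integrable_of_measurable_of_abs_le (μ := B.interactionLaw π h) hwid
    fun w => abs_width_le hN hc _
  have iA := integrable_of_measurable_of_abs_le (μ := B.interactionLaw π h) hUA fun w => hUb _
  have iB := integrable_of_measurable_of_abs_le (μ := B.interactionLaw π h) hUB fun w => hUb _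
  -- `U` depends only on the history, the context and the arm, as posterior sampling requires.
  have hswap : ∫ w, U (w.1.2, w.2.1, w.2.2.1) ∂(B.interactionLaw π h) =
      ∫ w, U (w.1.2, w.2.1, ρ.pick w.2.1 (B.mean w.1.1 w.2.1)) ∂(B.interactionLaw π h) := by
    rw [integral_interactionLaw π h hUA fun w => hUb _,
      integral_interactionLaw π h hUB fun w => hUb _]
    exact hπ.integral_arm_eq_integral_bestArm h hU hUb
  have hmono := integral_mono (μ := B.interactionLaw π h)
    (integrable_of_measurable_of_abs_le hgap fun w => hB.abs_gap_le ρ _ _)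
    ((((iI (-1)).add (iI 1)).add iW).add (iB.sub iA))
    fun w => hB.gap_le ρ hN hc w.1.1 w.1.2 w.2
  rw [integral_add' (((iI (-1)).add (iI 1)).add iW) (iB.sub iA),
    integral_add' ((iI (-1)).add (iI 1)) iW, integral_add' (iI (-1)) (iI 1),
    integral_sub' iB iA, hswap, sub_self, add_zero,
    integral_interactionLaw π h hgap fun w => hB.abs_gap_le ρ _ _] at hmono
  rw [roundRegret]
  linarith [hIint (-1) (by norm_num), hIint 1 (by norm_num)]

/-- By symmetry, `N` times one agent's expected width is the expected sum over the agents of the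
round, which the potential increment dominates pointwise. -/
lemma mul_integral_width_le (π : Policy S K N) (hN : 1 ≤ N) {c : ℝ} (hc : 0 ≤ c) (h : ℕ) :
    N * ∫ w, width N c (count w.1.2 (w.2.1, w.2.2.1)) ∂(B.interactionLaw π h) ≤
      ∫ q, totalPotential c q.2 ∂(B.jointLaw π (h + 1)) -
        ∫ q, totalPotential c q.2 ∂(B.jointLaw π h) := by
  set η := iidKernel N (B.agentKernel (π.act h))
  have hwid : Measurable fun y : Hist S K N h × S × Fin K => width N c (count y.1 y.2) :=
    measurable_width c
  have hw (n : Fin N) : Measurable fun w : (Θ × Hist S K N h) × Round S K N =>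
      width N c (count w.1.2 ((w.2 n).1, (w.2 n).2.1)) :=
    hwid.comp (f := fun w : (Θ × Hist S K N h) × Round S K N =>
      (w.1.2, (w.2 n).1, (w.2 n).2.1)) (by fun_prop)
  have iw (n : Fin N) := integrable_of_measurable_of_abs_le (μ := B.jointLaw π h ⊗ₘ η) (hw n)
    fun w => abs_width_le hN hc _
  have hm1 : Measurable fun w : (Θ × Hist S K N h) × Round S K N =>
      totalPotential c (append (w.1.2, w.2)) :=
    (measurable_totalPotential c).comp
      (measurable_append.comp (measurable_fst.snd.prodMk measurable_snd))
  have hm0 : Measurable fun w : (Θ × Hist S K N h) × Round S K N => totalPotential c w.1.2 :=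
    (measurable_totalPotential c).comp measurable_fst.snd
  have i1 := integrable_of_measurable_of_abs_le (μ := B.jointLaw π h ⊗ₘ η) hm1
    fun w => abs_totalPotential_le hN hc (append (w.1.2, w.2))
  have i0 := integrable_of_measurable_of_abs_le (μ := B.jointLaw π h ⊗ₘ η) hm0
    fun w => abs_totalPotential_le hN hc w.1.2
  have e1 : ∫ q, totalPotential c q.2 ∂(B.jointLaw π (h + 1)) =
      ∫ w, totalPotential c (append (w.1.2, w.2)) ∂(B.jointLaw π h ⊗ₘ η) := by
    rw [integral_jointLaw_succ B π (F := fun q => totalPotential c q.2)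
      ((measurable_totalPotential c).comp measurable_snd)
      fun q => abs_totalPotential_le hN hc q.2, Measure.integral_compProd i1]
  have e0 : ∫ q, totalPotential c q.2 ∂(B.jointLaw π h) =
      ∫ w, totalPotential c w.1.2 ∂(B.jointLaw π h ⊗ₘ η) := by
    rw [Measure.integral_compProd i0]
    simp
  have ew (n : Fin N) : ∫ w, width N c (count w.1.2 (w.2.1, w.2.2.1)) ∂(B.interactionLaw π h) =
      ∫ w, width N c (count w.1.2 ((w.2 n).1, (w.2 n).2.1)) ∂(B.jointLaw π h ⊗ₘ η) := by
    rw [integral_interactionLaw π h (measurable_width_interaction c h)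
      fun w => abs_width_le hN hc _, Measure.integral_compProd (iw n)]
    refine integral_congr_ae (ae_of_all _ fun q => ?_)
    refine (integral_iidKernel_eval (B.agentKernel (π.act h))
      (f := fun z => width N c (count q.2 (z.1, z.2.1))) ?_ q n).symm
    exact hwid.comp (f := fun z : S × Fin K × ℝ => (q.2, z.1, z.2.1)) (by fun_prop)
  have es : N * ∫ w, width N c (count w.1.2 (w.2.1, w.2.2.1)) ∂(B.interactionLaw π h) =
      ∫ w, ∑ n, width N c (count w.1.2 ((w.2 n).1, (w.2 n).2.1)) ∂(B.jointLaw π h ⊗ₘ η) := by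
    rw [integral_finsetSum _ fun n _ => iw n, ← Finset.sum_congr rfl fun n _ => ew n]
    simp
  rw [es, e1, e0, ← integral_sub i1 i0]
  exact integral_mono (integrable_finsetSum _ fun n _ => iw n) (i1.sub i0)
    fun w => sum_width_le_totalPotential_sub hN hc w.1.2 w.2

lemma IsThompsonSampling.mul_sum_roundRegret_le [StandardBorelSpace Θ] [Nonempty Θ]
    (hB : B.Normalized) {ρ : ArgmaxRule S K} {π : Policy S K N}
    (hπ : B.IsThompsonSampling ρ π) (hN : 1 ≤ N) {c : ℝ} (hc : 0 ≤ c) {H T : ℕ}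
    (hT : T = N * H) :
    N * ∑ h ∈ Finset.range H, B.roundRegret π ρ h ≤
      2 * K * Fintype.card S * T ^ 2 * Real.exp (-(c ^ 2 / 2)) +
        (K * Fintype.card S * (2 * N - 1) + 4 * c * √(K * Fintype.card S * T)) := by
  have h1 : N * ∑ h ∈ Finset.range H, B.roundRegret π ρ h ≤
      ∑ h ∈ Finset.range H, (N * (2 * (K * Fintype.card S * (T * Real.exp (-(c ^ 2 / 2))))) +
        (∫ q, totalPotential c q.2 ∂(B.jointLaw π (h + 1)) -
          ∫ q, totalPotential c q.2 ∂(B.jointLaw π h))) := by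
    rw [Finset.mul_sum]
    refine Finset.sum_le_sum fun h hh => ?_
    have hle : h * N ≤ T := by
      rw [hT, mul_comm]
      exact Nat.mul_le_mul_left N (Finset.mem_range.1 hh).le
    have := mul_le_mul_of_nonneg_left (hπ.roundRegret_le hB hN hc hle) (Nat.cast_nonneg (α := ℝ) N)
    rw [mul_add] at this
    linarith [mul_integral_width_le (B := B) π hN hc h]
  -- The potential telescopes; its initial value is only needed to be nonnegative.
  rw [Finset.sum_add_distrib, Finset.sum_range_sub
    fun h => ∫ q, totalPotential c q.2 ∂(B.jointLaw π h)] at h1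
  have h2 : 0 ≤ ∫ q, totalPotential c q.2 ∂(B.jointLaw π 0) :=
    integral_nonneg fun q => totalPotential_nonneg hN hc _
  have h3 : ∫ q, totalPotential c q.2 ∂(B.jointLaw π H) ≤
      K * Fintype.card S * (2 * N - 1) + 4 * c * √(K * Fintype.card S * T) := by
    have hTr : (T : ℝ) = H * N := by rw [hT]; push_cast; ring
    rw [hTr]
    exact integral_totalPotential_le π hN hc H
  have h4 : ∑ h ∈ Finset.range H,
      (N * (2 * (K * Fintype.card S * (T * Real.exp (-(c ^ 2 / 2)))))) =
        2 * K * Fintype.card S * T ^ 2 * Real.exp (-(c ^ 2 / 2)) := by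
    have hTr : (T : ℝ) = N * H := by rw [hT]; push_cast; ring
    rw [Finset.sum_const, Finset.card_range, nsmul_eq_mul]
    linear_combination (-2 * K * Fintype.card S * T * Real.exp (-(c ^ 2 / 2))) * hTr
  rw [h4] at h1
  linarith

/-- The per-agent regret bound of Thompson sampling, with the full gain from pooling. -/
lemma IsThompsonSampling.agentRegret_le [StandardBorelSpace Θ] [Nonempty Θ]
    (hB : B.Normalized) {ρ : ArgmaxRule S K} {π : Policy S K N}
    (hπ : B.IsThompsonSampling ρ π) {H T : ℕ} (n : Fin N) (hT : T = N * H) (hT1 : 1 ≤ T) :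
    B.agentRegret ρ π H n ≤ 2 * K * Fintype.card S +
      4 * √((2 + 6 * Real.log T) * K * Fintype.card S * T) / N := by
  have hN : 1 ≤ N := Fin.pos n
  have hN0 : (0 : ℝ) < N := by exact_mod_cast hN
  have hTr : (1 : ℝ) ≤ T := by exact_mod_cast hT1
  have hlog : 0 ≤ Real.log T := Real.log_nonneg hTr
  -- This makes `exp (-(c ^ 2 / 2)) = 1 / (e * T ^ 3)`, which beats the `T ^ 2` from the union over
  -- counts and the sum over rounds and agents.
  set c := √(2 + 6 * Real.log T) with hc
  have hc2 : c ^ 2 = 2 + 6 * Real.log T := Real.sq_sqrt (by positivity)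
  have hexp : (T : ℝ) ^ 2 * Real.exp (-(c ^ 2 / 2)) ≤ 1 / 2 := by
    have e : -(c ^ 2 / 2) = -(1 + 3 * Real.log T) := by rw [hc2]; ring
    have e3 : Real.exp (3 * Real.log T) = T ^ 3 := by
      have := Real.exp_nat_mul (Real.log T) 3
      rw [Real.exp_log (by linarith)] at this
      exact_mod_cast this
    rw [e, Real.exp_neg, Real.exp_add, e3, ← div_eq_mul_inv,
      div_le_div_iff₀ (by positivity) (by norm_num)]
    have he : (2 : ℝ) ≤ Real.exp 1 := by linarith [Real.add_one_le_exp (1 : ℝ)]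
    have h23 : (T : ℝ) ^ 2 ≤ T ^ 3 := pow_le_pow_right₀ hTr (by norm_num)
    nlinarith [mul_le_mul he h23 (by positivity) (by positivity)]
  have hmain := hπ.mul_sum_roundRegret_le hB hN (Real.sqrt_nonneg _ : 0 ≤ c) hT
  rw [← hB.agentRegret_eq π ρ H n] at hmain
  have hfail : 2 * K * Fintype.card S * T ^ 2 * Real.exp (-(c ^ 2 / 2)) ≤
      (K * Fintype.card S : ℝ) := by
    have := mul_le_mul_of_nonneg_left hexp (by positivity : (0 : ℝ) ≤ 2 * (K * Fintype.card S))
    linarith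
  have hsqrt : √((2 + 6 * Real.log T) * K * Fintype.card S * T) =
      c * √(K * Fintype.card S * T) := by
    rw [hc, ← Real.sqrt_mul (by positivity)]
    ring_nf
  -- The failure cost `K|S|` and the potential's `K|S| (2N - 1)` add up to exactly `2 N K|S|`.
  rw [hsqrt, ← mul_le_mul_iff_right₀ hN0, mul_add, mul_div_cancel₀ _ hN0.ne']
  linarith

end Bandit

end ContextualBandit

end

/-! ### The theorem: explicit constants -/

open ContextualBandit in
theorem theorem4 :
    ∃ C : ℝ, 0 < C ∧ ∃ T₀ : ℕ → ℕ → ℕ → ℕ,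
      ∀ (S : Type*) [Fintype S] [MeasurableSpace S] [DiscreteMeasurableSpace S]
        (Θ : Type*) [MeasurableSpace Θ] [StandardBorelSpace Θ] [Nonempty Θ]
        (K N : ℕ) (B : Bandit S Θ K) (ρ : ArgmaxRule S K) (π : Policy S K N),
        B.Normalized → B.IsThompsonSampling ρ π →
        ∀ (H T : ℕ) (n : Fin N), T = N * H →
          B.agentRegret ρ π H n = B.systemRegret ρ π H / N ∧
          B.agentRegret ρ π H n ≤
            2 * K * Fintype.card S +
              4 * Real.sqrt ((2 + 6 * Real.log T) * K * Fintype.card S * T / N) ∧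
          (T₀ K (Fintype.card S) N ≤ T →
            B.agentRegret ρ π H n ≤
              C * (1 / N * Real.sqrt (K * T * Fintype.card S * Real.log T))) := by
  -- `13 = 4 * 3 + 1`: the factor `3` absorbs `2 + 6 log T ≤ 9 log T`, valid since `T ≥ 3` gives
  -- `log T ≥ 1`. The `1` pays for `2 K|S| N`, which the other part of the threshold puts below the
  -- square root.
  refine ⟨13, by norm_num, fun K s N => 4 * K * s * N ^ 2 + 3, ?_⟩
  intro S _ _ _ Θ _ _ _ K N B ρ π hB hπ H T n hT
  have hN : 1 ≤ N := Fin.pos n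
  have hN1 : (1 : ℝ) ≤ N := by exact_mod_cast hN
  have hN0 : (0 : ℝ) < N := by linarith
  refine ⟨?_, ?_, fun hT0 => ?_⟩
  · rw [hB.agentRegret_eq, hB.systemRegret_eq, mul_div_cancel_left₀ _ hN0.ne']
  · rcases Nat.eq_zero_or_pos T with h0 | hpos
    · have hH : H = 0 := (Nat.mul_eq_zero.1 (hT.symm.trans h0)).resolve_left (by omega)
      subst hH
      rw [hB.agentRegret_eq, Finset.range_zero, Finset.sum_empty]
      positivity
    · refine (hπ.agentRegret_le hB n hT hpos).trans ?_
      rw [mul_div_assoc, Real.sqrt_div' _ hN0.le]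
      -- The proved bound has `N` outside the square root; the stated one is weaker because `√N ≤
      -- N`.
      have hsN : √(N : ℝ) ≤ N := Real.sqrt_le_iff.2 ⟨hN0.le, by nlinarith⟩
      have : 0 < √(N : ℝ) := Real.sqrt_pos.2 hN0
      gcongr
  · have hT3 : (3 : ℝ) ≤ T := by exact_mod_cast (Nat.le_add_left _ _).trans hT0
    have hT4 : (4 * K * Fintype.card S * N ^ 2 : ℝ) ≤ T := by
      exact_mod_cast (Nat.le_add_right _ _).trans hT0
    have hlog : 1 ≤ Real.log T := by
      rw [Real.le_log_iff_exp_le (by linarith)]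
      linarith [Real.exp_one_lt_d9]
    refine (hπ.agentRegret_le hB n hT (by exact_mod_cast (by linarith : (1 : ℝ) ≤ T))).trans ?_
    set L := Real.log T
    set k : ℝ := (K : ℝ) * Fintype.card S with hk
    have hk0 : 0 ≤ k := by positivity
    have e1 : (K * T * Fintype.card S * L : ℝ) = k * T * L := by rw [hk]; ring
    have e2 : ((2 + 6 * L) * K * Fintype.card S * T : ℝ) = (2 + 6 * L) * (k * T) := by
      rw [hk]; ring
    have h1 : √((2 + 6 * L) * (k * T)) ≤ 3 * √(k * T * L) := by
      rw [Real.sqrt_le_left (by positivity), mul_pow, Real.sq_sqrt (by positivity)]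
      nlinarith [mul_nonneg hk0 (by linarith : (0 : ℝ) ≤ T)]
    have h2 : 2 * k * N ≤ √(k * T * L) := by
      refine Real.le_sqrt_of_sq_le ?_
      have h3 : 4 * k * N ^ 2 ≤ T := by rw [hk]; linarith
      calc (2 * k * N) ^ 2 = k * (4 * k * N ^ 2) := by ring
        _ ≤ k * T := by gcongr
        _ ≤ k * T * L := le_mul_of_one_le_right (by positivity) hlog
    rw [e1, e2, ← mul_le_mul_iff_right₀ hN0, mul_add, mul_div_cancel₀ _ hN0.ne']
    have e3 : (N : ℝ) * (13 * (1 / N * √(k * T * L))) = 13 * √(k * T * L) := by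
      field_simp
    have e4 : (N : ℝ) * (2 * K * Fintype.card S) = 2 * k * N := by rw [hk]; ring
    rw [e3, e4]
    linarith
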